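/- Let $k\ge 1$ be an integer and let $\mathcal V$ be the vertex set of the rooted regular tree with $k$-fold branching (every vertex has exactly $k$ children); $|v|$ denotes the distance from $v$ to the root. On $\ell^2(\mathcal V)$ let $(L\phi)(v)=\sum_{w\sim v}\phi(w)$, let $d_0$ be the function equal to $1$ at the root and $0$ elsewhere, and, for a bounded $V:\mathcal V\to\mathbb C$ (identified with the multiplication operator), let $-\Delta_V:=-L+k+1+V$. Let $M:\mathcal V\to\mathbb C$ satisfy $|M(v)|\le \mathrm{Const.}\,e^{-\delta|v|}$ with $\delta>0$ if $k=1$ and $\delta\ge 6\ln k$ if $k\ge 2$, and put $\widetilde M:=-d_0+M$. Let $t_\pm(k)=k+1\pm2\sqrt k$, $z_{t_\pm}(\lambda)=t_\pm(k)\mp\sqrt k\,\lambda^2$, and $e_-(v)=e^{-\frac\delta2|v|}$. There is $\varepsilon_0>0$, depending only on $k$ and $\delta$, such that, for every such $M$ and for $V=\widetilde M$ as well as $V=-\widetilde M$: the weighted resolvent $\lambda\mapsto e_-\big(-\Delta_{V}-z_{t_-}(\lambda)\big)^{-1}e_-$ extends meromorphically from $\{0<|\lambda|<\varepsilon_0,\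 \operatorname{Im}\lambda>0\}$ to $\{0<|\lambda|<\varepsilon_0\}$, with values in the bounded operators on $\ell^2(\mathcal V)$; and, with $V=J|V|$ the polar decomposition, $\lambda\mapsto J\sqrt{|V|}\,\big(-L+k+1-z_{t_-}(\lambda)\big)^{-1}\sqrt{|V|}$ extends holomorphically from the same half disc to $\{0<|\lambda|<\varepsilon_0\}$, to a function denoted $\mathcal T_{V}(\lambda)$. The point $z_{t_-}(\lambda)$, $0<|\lambda|<\varepsilon_0$, is called a resonance of $-\Delta_{\widetilde M}$ near $t_-(k)$ if $\lambda$ is a pole of the first extension for $V=\widetilde M$, and $z_{t_+}(\lambda)$ is called a resonance of $-\Delta_{\widetilde M}$ near $t_+(k)$ if $\lambda$ is a pole of the first extension for $V=-\widetilde M$ (note $2(k+1)-z_{t_+}(\lambda)=z_{t_-}(\lambda)$; conjugation by $\phi(v)\mapsto(-1)^{|v|}\phi(v)$ turns $e_-(-\Delta_{\widetilde M}-z)^{-1}e_-$ into $-e_-(-\Delta_{-\widetilde M}-(2(k+1)-z))^{-1}e_-$). The multiplicity of the resonance $z_{t_\mp}(\lambda)$ is $\frac1{2\pi i}\operatorname{Tr}\oint_\gamma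 F'(w)F(w)^{-1}\,dw$ with $F=I+\mathcal T_{\pm\widetilde M}$ and $\gamma$ a small positively oriented circle around $\lambda$. Theorem 1 (Absence of resonances). For every such $M$ and all sufficiently small $r>0$, there is no $\lambda$ with $0<|\lambda|<r$ such that $z_{t_-}(\lambda)$ is a resonance of $-\Delta_{\widetilde M}$ near $t_-(k)$ or $z_{t_+}(\lambda)$ is a resonance of $-\Delta_{\widetilde M}$ near $t_+(k)$; that is, for each sign, the number of resonances $z_{t_\pm}(\lambda)$ with $0<|\lambda|<r$, counted with multiplicity, is $0$. -/

import Mathlib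

open scoped ENNReal Topology

noncomputable section

namespace TreeRes

/-- The vertices of the rooted tree with `k`-fold branching: the root is `[]`, and the `k`
children of `v` are `i :: v`, `i : Fin k`. The distance of `v` to the root is `v.length`. -/
abbrev Vertex (k : ℕ) : Type := List (Fin k)

/-- The rooted `k`-regular tree: the edges join each vertex to its `k` children. -/
def tree (k : ℕ) : SimpleGraph (Vertex k) where
  Adj v w := (∃ i : Fin k, w = i :: v) ∨ (∃ i : Fin k, v = i :: w)
  symm := ⟨fun _ _ h => h.symm⟩
  loopless := ⟨fun v h => by
    rcases h with ⟨i, h⟩ | ⟨i, h⟩ <;> exact absurd (congrArg List.length h) (by simp)⟩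

/-- The neighbours of a vertex: its children, and its parent if it is not the root. -/
def nbrs {k : ℕ} (v : Vertex k) : Finset (Vertex k) :=
  (Finset.univ.image fun i : Fin k => i :: v) ∪
    (match v with
      | [] => ∅
      | _ :: u => {u})

theorem mem_nbrs {k : ℕ} (v w : Vertex k) : w ∈ nbrs v ↔ (tree k).Adj v w := by
  cases v <;> simp [nbrs, tree, eq_comm, or_comm]

theorem mem_nbrs_comm {k : ℕ} (v w : Vertex k) : w ∈ nbrs v ↔ v ∈ nbrs w := by
  rw [mem_nbrs, mem_nbrs, SimpleGraph.adj_comm]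

theorem card_nbrs_le {k : ℕ} (v : Vertex k) : (nbrs v).card ≤ k + 1 := by
  refine (Finset.card_union_le _ _).trans (Nat.add_le_add ?_ ?_)
  · exact Finset.card_image_le.trans (by simp)
  · cases v <;> simp

instance (k : ℕ) : (tree k).LocallyFinite := fun v =>
  Fintype.ofFinset (nbrs v) fun w => mem_nbrs v w

theorem neighborFinset_eq {k : ℕ} (v : Vertex k) : (tree k).neighborFinset v = nbrs v := by
  ext w
  rw [SimpleGraph.mem_neighborFinset, mem_nbrs]

/-- The Hilbert space `ℓ²(𝒱)`. -/
abbrev Ell2 (k : ℕ) : Type := lp (fun _ : Vertex k => ℂ) 2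

/-- The bounded linear operators on `ℓ²(𝒱)`. -/
abbrev Op (k : ℕ) : Type := Ell2 k →L[ℂ] Ell2 k

theorem sum_sq_le {k : ℕ} (φ : Ell2 k) (s : Finset (Vertex k)) :
    ∑ v ∈ s, ‖φ v‖ ^ 2 ≤ ‖φ‖ ^ 2 := by
  have h := lp.sum_rpow_le_norm_rpow (p := 2) (by norm_num) φ s
  simpa using h

theorem memlp_of_sum_sq_le {k : ℕ} {f : Vertex k → ℂ} {C : ℝ}
    (h : ∀ s : Finset (Vertex k), ∑ v ∈ s, ‖f v‖ ^ 2 ≤ C) : Memℓp f 2 :=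
  memℓp_gen' (C := C) fun s => by simpa using h s

theorem norm_le_of_sum_sq_le {k : ℕ} {f : Ell2 k} {C : ℝ} (hC : 0 ≤ C)
    (h : ∀ s : Finset (Vertex k), ∑ v ∈ s, ‖f v‖ ^ 2 ≤ C ^ 2) : ‖f‖ ≤ C :=
  lp.norm_le_of_forall_sum_le (p := 2) (by norm_num) hC fun s => by simpa using h s

theorem sum_sq_adj_le {k : ℕ} (φ : Ell2 k) (s : Finset (Vertex k)) :
    ∑ v ∈ s, ‖∑ w ∈ (tree k).neighborFinset v, φ w‖ ^ 2 ≤ (((k : ℝ) + 1) * ‖φ‖) ^ 2 := by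
  have h1 : ∀ v : Vertex k, ‖∑ w ∈ (tree k).neighborFinset v, φ w‖ ^ 2 ≤
      ((k : ℝ) + 1) * ∑ w ∈ nbrs v, ‖φ w‖ ^ 2 := fun v => by
    rw [neighborFinset_eq]
    have hc : ((nbrs v).card : ℝ) ≤ (k : ℝ) + 1 := by exact_mod_cast card_nbrs_le v
    calc ‖∑ w ∈ nbrs v, φ w‖ ^ 2 ≤ (∑ w ∈ nbrs v, ‖φ w‖) ^ 2 := by
          gcongr; exact norm_sum_le _ _
      _ ≤ (nbrs v).card * ∑ w ∈ nbrs v, ‖φ w‖ ^ 2 := sq_sum_le_card_mul_sum_sq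
      _ ≤ _ := by gcongr
  have h2 : ∑ v ∈ s, ∑ w ∈ nbrs v, ‖φ w‖ ^ 2 =
      ∑ w ∈ s.biUnion nbrs, ∑ v ∈ s ∩ nbrs w, ‖φ w‖ ^ 2 := by
    refine Finset.sum_comm' fun v w => ?_
    simp only [Finset.mem_inter, Finset.mem_biUnion, mem_nbrs_comm v w]
    constructor
    · rintro ⟨hv, hw⟩
      exact ⟨⟨hv, hw⟩, v, hv, (mem_nbrs_comm v w).2 hw⟩
    · rintro ⟨h, -⟩
      exact h
  calc ∑ v ∈ s, ‖∑ w ∈ (tree k).neighborFinset v, φ w‖ ^ 2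
      ≤ ∑ v ∈ s, ((k : ℝ) + 1) * ∑ w ∈ nbrs v, ‖φ w‖ ^ 2 := Finset.sum_le_sum fun v _ => h1 v
    _ = ((k : ℝ) + 1) * ∑ w ∈ s.biUnion nbrs, ∑ v ∈ s ∩ nbrs w, ‖φ w‖ ^ 2 := by
        rw [← Finset.mul_sum, h2]
    _ ≤ ((k : ℝ) + 1) * ∑ w ∈ s.biUnion nbrs, ((k : ℝ) + 1) * ‖φ w‖ ^ 2 := by
        gcongr with w _
        rw [Finset.sum_const, nsmul_eq_mul]
        gcongr
        have : (s ∩ nbrs w).card ≤ k + 1 :=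
          (Finset.card_le_card Finset.inter_subset_right).trans (card_nbrs_le w)
        exact_mod_cast this
    _ ≤ (((k : ℝ) + 1) * ‖φ‖) ^ 2 := by
        rw [← Finset.mul_sum, mul_pow, sq ((k : ℝ) + 1), mul_assoc]
        gcongr
        exact sum_sq_le φ _

/-- The operator `L` on `ℓ²(𝒱)`: `(L φ)(v) = ∑_{w ∼ v} φ(w)`. -/
def adjOp (k : ℕ) : Op k :=
  LinearMap.mkContinuous
    { toFun := fun φ =>
        (⟨fun v => ∑ w ∈ (tree k).neighborFinset v, φ w,
          memlp_of_sum_sq_le (sum_sq_adj_le φ)⟩ : Ell2 k)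
      map_add' := fun φ ψ => by
        ext v
        exact Finset.sum_add_distrib
      map_smul' := fun c φ => by
        ext v
        exact (Finset.mul_sum _ _ _).symm }
    ((k : ℝ) + 1)
    fun φ => norm_le_of_sum_sq_le (by positivity) (sum_sq_adj_le φ)

theorem sum_sq_mul_le {k : ℕ} {f : Vertex k → ℂ} (hf : BddAbove (Set.range fun v => ‖f v‖))
    (φ : Ell2 k) (s : Finset (Vertex k)) :
    ∑ v ∈ s, ‖f v * φ v‖ ^ 2 ≤ ((⨆ v, ‖f v‖) * ‖φ‖) ^ 2 := by
  calc ∑ v ∈ s, ‖f v * φ v‖ ^ 2 ≤ ∑ v ∈ s, (⨆ v, ‖f v‖) ^ 2 * ‖φ v‖ ^ 2 := by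
        refine Finset.sum_le_sum fun v _ => ?_
        rw [norm_mul, mul_pow]
        gcongr
        exact le_ciSup hf v
    _ ≤ ((⨆ v, ‖f v‖) * ‖φ‖) ^ 2 := by
        rw [← Finset.mul_sum, mul_pow]
        gcongr
        exact sum_sq_le φ s

open Classical in
/-- The operator of multiplication by a bounded function `f` on `ℓ²(𝒱)`
(by convention `0` if `f` is unbounded, a case that never occurs below). -/
def mulOp {k : ℕ} (f : Vertex k → ℂ) : Op k :=
  if hf : BddAbove (Set.range fun v => ‖f v‖) then
    LinearMap.mkContinuous
      { toFun := fun φ =>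
          (⟨fun v => f v * φ v, memlp_of_sum_sq_le (sum_sq_mul_le hf φ)⟩ : Ell2 k)
        map_add' := fun φ ψ => by
          ext v
          exact mul_add _ _ _
        map_smul' := fun c φ => by
          ext v
          exact mul_left_comm _ _ _ }
      (⨆ v, ‖f v‖)
      fun φ => norm_le_of_sum_sq_le
        (mul_nonneg (Real.iSup_nonneg fun _ => norm_nonneg _) (norm_nonneg _))
        (sum_sq_mul_le hf φ)
  else 0

/-- The unperturbed operator `-L + k + 1`. -/
def freeOp (k : ℕ) : Op k := -adjOp k + algebraMap ℂ (Op k) ((k : ℂ) + 1)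

/-- The perturbed operator `-L + k + 1 + V`, for a bounded potential `V`. -/
def schrodinger (k : ℕ) (V : Vertex k → ℂ) : Op k := freeOp k + mulOp V

/-- The potential `-d₀ + M`, where `d₀` is `1` at the root and `0` elsewhere. -/
def tilde {k : ℕ} (M : Vertex k → ℂ) : Vertex k → ℂ := fun v => -(if v = [] then 1 else 0) + M v

/-- The resolvent `(A - z)⁻¹` at a point `z` of the resolvent set of `A`. -/
def res {k : ℕ} (A : Op k) (z : ℂ) : Op k := Ring.inverse (A - algebraMap ℂ (Op k) z)

/-- The weight `e₋(v) = exp(-δ|v|/2)`. -/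
def weight {k : ℕ} (δ : ℝ) (v : Vertex k) : ℂ := (Real.exp (-(δ / 2) * v.length) : ℝ)

/-- The weighted resolvent `e₋ (-L + k + 1 + V - z)⁻¹ e₋` on `ℓ²(𝒱)`. Multiplication by
`exp(∓δ|v|/2)` being an isometry of `ℓ²(𝒱)` onto the weighted space
`exp(∓δ|v|/2) ℓ²(𝒱)`, this is the resolvent as an operator from
`exp(-δ|v|/2) ℓ²(𝒱)` to `exp(δ|v|/2) ℓ²(𝒱)`. -/
def weightedRes (k : ℕ) (δ : ℝ) (V : Vertex k → ℂ) (z : ℂ) : Op k :=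
  mulOp (weight δ) * res (schrodinger k V) z * mulOp (weight δ)

/-- The threshold `t₋(k) = k + 1 - 2√k`. -/
def tMinus (k : ℕ) : ℂ := (k : ℂ) + 1 - 2 * (√(k : ℝ) : ℝ)

/-- The threshold `t₊(k) = k + 1 + 2√k`. -/
def tPlus (k : ℕ) : ℂ := (k : ℂ) + 1 + 2 * (√(k : ℝ) : ℝ)

/-- The parametrization `z = t₋(k) + √k w²` near `t₋(k)`. -/
def zMinus (k : ℕ) (w : ℂ) : ℂ := tMinus k + (√(k : ℝ) : ℝ) * w ^ 2

/-- The parametrization `z = t₊(k) - √k w²` near `t₊(k)`. -/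
def zPlus (k : ℕ) (w : ℂ) : ℂ := tPlus k - (√(k : ℝ) : ℝ) * w ^ 2

/-- The punctured disc `0 < |w| < r`. -/
def pdisc (r : ℝ) : Set ℂ := {w | 0 < ‖w‖ ∧ ‖w‖ < r}

/-- `R` is a meromorphic extension to the punctured disc of radius `ε` of the weighted resolvent
`w ↦ e₋ (-L + k + 1 + V - ζ(w))⁻¹ e₋`, given on the upper half `Im w > 0` of that disc (at those
`w` for which `ζ(w)` lies in the resolvent set). -/
structure IsResExtension (k : ℕ) (δ : ℝ) (V : Vertex k → ℂ) (ζ : ℂ → ℂ) (ε : ℝ)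
    (R : ℂ → Op k) : Prop where
  meromorphicOn : MeromorphicOn R (pdisc ε)
  eq_weightedRes : ∀ w ∈ pdisc ε, 0 < w.im → ζ w ∈ resolventSet ℂ (schrodinger k V) →
    R w = weightedRes k δ V (ζ w)

/-- The poles in the punctured disc of radius `ε` of the meromorphic extension of the weighted
resolvent. -/
def extensionPoles (k : ℕ) (δ : ℝ) (V : Vertex k → ℂ) (ζ : ℂ → ℂ) (ε : ℝ) : Set ℂ :=
  {w ∈ pdisc ε | ∃ R, IsResExtension k δ V ζ ε R ∧ meromorphicOrderAt R w < 0}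

/-- The operator `J √|V| (-L + k + 1 - z)⁻¹ √|V|`, where `V = J |V|`. -/
def sandwich (k : ℕ) (V : Vertex k → ℂ) (z : ℂ) : Op k :=
  mulOp (fun v => V v / ‖V v‖) * mulOp (fun v => (√‖V v‖ : ℝ)) * res (freeOp k) z *
    mulOp (fun v => (√‖V v‖ : ℝ))

/-- `T` is a holomorphic extension to the punctured disc of radius `ε` of
`w ↦ J √|V| (-L + k + 1 - ζ(w))⁻¹ √|V|`, given on the upper half `Im w > 0` of that disc. -/
structure IsSandwichExtension (k : ℕ) (V : Vertex k → ℂ) (ζ : ℂ → ℂ) (ε : ℝ)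
    (T : ℂ → Op k) : Prop where
  differentiableOn : DifferentiableOn ℂ T (pdisc ε)
  eq_sandwich : ∀ w ∈ pdisc ε, 0 < w.im → T w = sandwich k V (ζ w)

open Classical in
/-- The holomorphic extension of `w ↦ J √|V| (-L + k + 1 - ζ(w))⁻¹ √|V|` to the punctured disc of
radius `ε` (on which it is unique). -/
def sandwichExt (k : ℕ) (V : Vertex k → ℂ) (ζ : ℂ → ℂ) (ε : ℝ) : ℂ → Op k :=
  if h : ∃ T, IsSandwichExtension k V ζ ε T then h.choose else 0

/-- The trace `∑_v ⟨A δ_v, δ_v⟩` of a trace class operator on `ℓ²(𝒱)`. -/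
def trace {k : ℕ} (A : Op k) : ℂ := ∑' v : Vertex k, A (lp.single 2 v 1) v

/-- The index `(2πi)⁻¹ Tr ∮ F'(w) F(w)⁻¹ dw` of `F` along the circle `|w - c| = ρ`. -/
def index {k : ℕ} (F : ℂ → Op k) (c : ℂ) (ρ : ℝ) : ℂ :=
  (2 * Real.pi * Complex.I)⁻¹ * trace (∮ w in C(c, ρ), deriv F w * Ring.inverse (F w))

/-- The multiplicity at `c`: the index of `w ↦ I + J √|V| (-L + k + 1 - ζ(w))⁻¹ √|V|` (extended)
along all sufficiently small circles around `c`. -/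
def mult (k : ℕ) (V : Vertex k → ℂ) (ζ : ℂ → ℂ) (ε : ℝ) (c : ℂ) : ℂ :=
  Filter.limUnder (𝓝[>] (0 : ℝ)) fun ρ => index (fun w => 1 + sandwichExt k V ζ ε w) c ρ

/-- The set of all `w` with `0 < |w| < ε` for which `t₋(k) + √k w²` is a resonance of
`-L + k + 1 + V` near `t₋(k)`. -/
def resMinus (k : ℕ) (δ : ℝ) (V : Vertex k → ℂ) (ε : ℝ) : Set ℂ :=
  extensionPoles k δ V (zMinus k) ε

/-- The multiplicity of the resonance `t₋(k) + √k w²`. -/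
def multMinus (k : ℕ) (V : Vertex k → ℂ) (ε : ℝ) (w : ℂ) : ℂ := mult k V (zMinus k) ε w

/-- The set of all `w` with `0 < |w| < ε` for which `z = t₊(k) - √k w²` is a resonance of
`-L + k + 1 + V` near `t₊(k)`. By conjugation with `φ(v) ↦ (-1)^|v| φ(v)`, the weighted resolvent
of `-L + k + 1 + V` at `z` is unitarily equivalent to minus that of `-L + k + 1 - V` at
`2(k + 1) - z`; the resonances near `t₊(k)` are the poles of the extension of the latter. -/
def resPlus (k : ℕ) (δ : ℝ) (V : Vertex k → ℂ) (ε : ℝ) : Set ℂ :=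
  extensionPoles k δ (-V) (fun w => 2 * ((k : ℂ) + 1) - zPlus k w) ε

/-- The multiplicity of the resonance `t₊(k) - √k w²`. -/
def multPlus (k : ℕ) (V : Vertex k → ℂ) (ε : ℝ) (w : ℂ) : ℂ :=
  mult k (-V) (fun w => 2 * ((k : ℂ) + 1) - zPlus k w) ε w

end TreeRes

end

open TreeRes

noncomputable section

namespace TreeRes

/-! Write `L = D + U`, with `U` the pull-back from the parent and `D = U*` the sum over children, so
that `D U = k`. For `z = k + 1 - k t - t⁻¹` this gives the factorization `-L + k + 1 - z = t⁻¹ (1 -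
t D)(1 - t U)` (`freeOp_sub`), and the free resolvent is `t (1 - t U)⁻¹ (1 - t D)⁻¹` for `|t| <
1/√k`. The weight commutes with `U` and `D` up to the factor `q = exp(-δ/2)`, so the weighted free
resolvent is `t (1 - t q U)⁻¹ e₋² (1 - t q D)⁻¹`. This is holomorphic for `|t| < exp(δ/2)/√k`, a
disc containing the threshold point `t = 1/√k` in its interior.

With `V = e₋ B e₋` and `W(t)` the extended weighted free resolvent, the weighted perturbed resolvent
is `(1 + W(t) B)⁻¹ W(t)`. As `e₋²` is compact, there are holomorphic `d` and `N` with `(1 + W B) N =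
d` (`exists_det_extRes`), and `d 0 = 1` because `W(0) = 0`. Hence `d` is not identically zero on the
disc, its zeros are isolated, and some punctured neighbourhood of `1/√k` contains none. The
injective holomorphic change of variable `t = τ(w)` of `exists_param` carries this to a punctured
disc in `w`. There the extension has no pole, and the sums of multiplicities are empty. The upper
threshold is the same statement for `-V`. -/

/-! ### Multiplication operators. -/

theorem mulOp_apply {k : ℕ} {f : Vertex k → ℂ} (hf : BddAbove (Set.range fun v => ‖f v‖))
    (φ : Ell2 k) (v : Vertex k) : mulOp f φ v = f v * φ v := by
  rw [mulOp, dif_pos hf]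
  rfl

theorem adjOp_apply {k : ℕ} (φ : Ell2 k) (v : Vertex k) : adjOp k φ v = ∑ w ∈ nbrs v, φ w := by
  rw [← neighborFinset_eq]
  rfl

theorem bddAbove_norm {k : ℕ} {f : Vertex k → ℂ} {C : ℝ} (h : ∀ v, ‖f v‖ ≤ C) :
    BddAbove (Set.range fun v => ‖f v‖) :=
  ⟨C, by rintro _ ⟨v, rfl⟩; exact h v⟩

theorem norm_mulOp_le {k : ℕ} {f : Vertex k → ℂ} {C : ℝ} (h : ∀ v, ‖f v‖ ≤ C) :
    ‖mulOp f‖ ≤ C := by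
  rw [mulOp, dif_pos (bddAbove_norm h)]
  exact (LinearMap.mkContinuous_norm_le _ (Real.iSup_nonneg fun _ => norm_nonneg _) _).trans
    (ciSup_le h)

theorem mulOp_mul {k : ℕ} {f g : Vertex k → ℂ} {C D : ℝ} (hf : ∀ v, ‖f v‖ ≤ C)
    (hg : ∀ v, ‖g v‖ ≤ D) : mulOp f * mulOp g = mulOp fun v => f v * g v := by
  have hfg : ∀ v, ‖f v * g v‖ ≤ C * D := fun v => by
    rw [norm_mul]
    exact mul_le_mul (hf v) (hg v) (norm_nonneg _) ((norm_nonneg _).trans (hf v))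
  ext φ v
  rw [mul_apply_eq_comp, mulOp_apply (bddAbove_norm hf),
    mulOp_apply (bddAbove_norm hg), mulOp_apply (bddAbove_norm hfg), mul_assoc]

/-! ### The parent and children operators. -/

/-- The function `v ↦ φ(parent of v)`, vanishing at the root. -/
def pull {k : ℕ} (φ : Vertex k → ℂ) : Vertex k → ℂ
  | [] => 0
  | _ :: u => φ u

/-- Each value of `φ` is repeated at the `k` children of its vertex, and the root contributes
nothing. -/
theorem sum_sq_pull_le {k : ℕ} (φ : Ell2 k) (s : Finset (Vertex k)) :
    ∑ v ∈ s, ‖pull φ v‖ ^ 2 ≤ (√(k : ℝ) * ‖φ‖) ^ 2 := by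
  classical
  let e : Fin k × Vertex k ↪ Vertex k := ⟨fun p => p.1 :: p.2, fun p q h => by
    simpa [Prod.ext_iff] using h⟩
  let t : Finset (Vertex k) := s.image List.tail
  have h1 : ∑ v ∈ s, ‖pull φ v‖ ^ 2 ≤
      ∑ v ∈ insert [] ((Finset.univ ×ˢ t).map e), ‖pull φ v‖ ^ 2 := by
    refine Finset.sum_le_sum_of_subset_of_nonneg (fun v hv => ?_) fun _ _ _ => by positivity
    cases v with
    | nil => simp
    | cons i u =>
      refine Finset.mem_insert_of_mem (Finset.mem_map.2 ⟨(i, u), ?_, rfl⟩)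
      exact Finset.mem_product.2 ⟨Finset.mem_univ _, Finset.mem_image.2 ⟨i :: u, hv, rfl⟩⟩
  have h2 : (([] : Vertex k)) ∉ (Finset.univ ×ˢ t).map e := by simp [e]
  rw [Finset.sum_insert h2, Finset.sum_map, Finset.sum_product] at h1
  calc ∑ v ∈ s, ‖pull φ v‖ ^ 2 ≤ ∑ _i : Fin k, ∑ u ∈ t, ‖φ u‖ ^ 2 := by
        rwa [pull, norm_zero, zero_pow two_ne_zero, zero_add] at h1
    _ ≤ ∑ _i : Fin k, ‖φ‖ ^ 2 := Finset.sum_le_sum fun _ _ => sum_sq_le φ t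
    _ = _ := by simp [mul_pow]

/-- The operator `(U φ)(v) = φ(parent of v)` on `ℓ²(𝒱)`, with `(U φ)(root) = 0`. -/
def pullOp (k : ℕ) : Op k :=
  LinearMap.mkContinuous
    { toFun := fun φ => (⟨pull φ, memlp_of_sum_sq_le (sum_sq_pull_le φ)⟩ : Ell2 k)
      map_add' := fun φ ψ => by
        ext v
        cases v
        · exact (add_zero _).symm
        · rfl
      map_smul' := fun c φ => by
        ext v
        cases v
        · exact (mul_zero _).symm
        · rfl }
    √(k : ℝ)
    fun φ => norm_le_of_sum_sq_le (by positivity) (sum_sq_pull_le φ)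

theorem pullOp_nil {k : ℕ} (φ : Ell2 k) : pullOp k φ [] = 0 := rfl

theorem pullOp_cons {k : ℕ} (φ : Ell2 k) (i : Fin k) (u : Vertex k) :
    pullOp k φ (i :: u) = φ u := rfl

theorem norm_pullOp_le (k : ℕ) : ‖pullOp k‖ ≤ √(k : ℝ) :=
  LinearMap.mkContinuous_norm_le _ (by positivity) _

/-- The operator `(D φ)(v) = ∑ φ(w)`, the sum over the children `w` of `v`. -/
def pushOp (k : ℕ) : Op k := ContinuousLinearMap.adjoint (pullOp k)

theorem norm_pushOp_le (k : ℕ) : ‖pushOp k‖ ≤ √(k : ℝ) := by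
  rw [pushOp, LinearIsometryEquiv.norm_map]
  exact norm_pullOp_le k

theorem pullOp_single {k : ℕ} (v : Vertex k) :
    pullOp k (lp.single 2 v 1) = ∑ i : Fin k, lp.single 2 (i :: v) (1 : ℂ) := by
  ext w
  rw [lp.coeFn_sum, Finset.sum_apply]
  cases w with
  | nil => simp [pullOp_nil]
  | cons j u => simp [pullOp_cons, Pi.single_apply, ite_and]

theorem pushOp_apply {k : ℕ} (φ : Ell2 k) (v : Vertex k) :
    pushOp k φ v = ∑ i : Fin k, φ (i :: v) := by
  have h : inner ℂ (lp.single 2 v (1 : ℂ)) (pushOp k φ) =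
      inner ℂ (pullOp k (lp.single 2 v 1)) φ :=
    ContinuousLinearMap.adjoint_inner_right _ _ _
  rw [pullOp_single, sum_inner] at h
  simpa [lp.inner_single_left] using h

theorem adjOp_eq (k : ℕ) : adjOp k = pushOp k + pullOp k := by
  ext φ v
  rw [adjOp_apply, add_apply, lp.coeFn_add, Pi.add_apply, pushOp_apply]
  cases v with
  | nil =>
    rw [pullOp_nil, add_zero, nbrs, Finset.union_empty, Finset.sum_image]
    intro a _ b _ h
    simpa using h
  | cons j u =>
    rw [pullOp_cons, nbrs, Finset.sum_union, Finset.sum_image, Finset.sum_singleton]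
    · intro a _ b _ h
      simpa using h
    · rw [Finset.disjoint_singleton_right, Finset.mem_image]
      rintro ⟨i, -, h⟩
      exact absurd (congrArg List.length h) (by simp; omega)

/-- The one algebraic relation behind the factorization in `freeOp_sub`. The order matters: `U D` is
not a scalar in general. -/
theorem pushOp_mul_pullOp (k : ℕ) : pushOp k * pullOp k = algebraMap ℂ (Op k) k := by
  ext φ v
  rw [mul_apply_eq_comp, pushOp_apply]
  simp [pullOp_cons]

/-! ### Commuting the weight past the tree operators. -/

/-- The multiplication by `exp(-δ|v|/2)`. -/
abbrev wOp (k : ℕ) (δ : ℝ) : Op k := mulOp (weight δ)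

theorem norm_weight {k : ℕ} (δ : ℝ) (v : Vertex k) :
    ‖weight δ v‖ = Real.exp (-(δ / 2) * v.length) := by
  rw [weight, Complex.norm_real, Real.norm_of_nonneg (Real.exp_pos _).le]

theorem norm_weight_le {k : ℕ} {δ : ℝ} (hδ : 0 < δ) (v : Vertex k) : ‖weight δ v‖ ≤ 1 := by
  rw [norm_weight, Real.exp_le_one_iff]
  have : (0 : ℝ) ≤ v.length := by positivity
  nlinarith

theorem weight_cons {k : ℕ} (δ : ℝ) (i : Fin k) (v : Vertex k) :
    weight δ (i :: v) = (Real.exp (-(δ / 2)) : ℝ) * weight δ v := by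
  rw [weight, weight, ← Complex.ofReal_mul, ← Real.exp_add, List.length_cons]
  congr 2
  push_cast
  ring

/-- A child is one step further from the root. The factor gained, smaller than `1`, is what enlarges
the disc of holomorphy in `t`. -/
theorem wOp_mul_pullOp (k : ℕ) {δ : ℝ} (hδ : 0 < δ) :
    wOp k δ * pullOp k = ((Real.exp (-(δ / 2)) : ℝ) : ℂ) • (pullOp k * wOp k δ) := by
  have hw := bddAbove_norm (norm_weight_le (k := k) hδ)
  ext φ v
  rw [smul_apply, lp.coeFn_smul, Pi.smul_apply,
    mul_apply_eq_comp, mul_apply_eq_comp, mulOp_apply hw, smul_eq_mul]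
  cases v with
  | nil => simp [pullOp_nil]
  | cons i u => rw [pullOp_cons, pullOp_cons, mulOp_apply hw, weight_cons, mul_assoc]

theorem pushOp_mul_wOp (k : ℕ) {δ : ℝ} (hδ : 0 < δ) :
    pushOp k * wOp k δ = ((Real.exp (-(δ / 2)) : ℝ) : ℂ) • (wOp k δ * pushOp k) := by
  have hw := bddAbove_norm (norm_weight_le (k := k) hδ)
  ext φ v
  rw [smul_apply, lp.coeFn_smul, Pi.smul_apply,
    mul_apply_eq_comp, mul_apply_eq_comp, mulOp_apply hw, smul_eq_mul,
    pushOp_apply, pushOp_apply, Finset.mul_sum, Finset.mul_sum]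
  refine Finset.sum_congr rfl fun i _ => ?_
  rw [mulOp_apply hw, weight_cons, mul_assoc]

/-! ### Inverses of finite rank perturbations of the identity -/

/-- The matrix units of `ℓ²(𝒱)`. -/
def unitOp {k : ℕ} (u v : Vertex k) : Op k :=
  (lp.evalCLM ℂ (fun _ : Vertex k => ℂ) 2 v).smulRight (lp.single 2 u (1 : ℂ))

theorem unitOp_apply {k : ℕ} (u v : Vertex k) (φ : Ell2 k) :
    unitOp u v φ = φ v • lp.single 2 u (1 : ℂ) := rfl

theorem unitOp_mul_mul_unitOp {k : ℕ} (u v u' v' : Vertex k) (Y : Op k) :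
    unitOp u v * Y * unitOp u' v' = (Y (lp.single 2 u' 1) v) • unitOp u v' := by
  ext φ w
  simp only [mul_apply_eq_comp, unitOp_apply, map_smul, smul_apply, lp.coeFn_smul, Pi.smul_apply,
    smul_eq_mul]
  ring

/-- The operator with a given matrix on the span of finitely many `δ_v`. -/
def matOp {k : ℕ} {s : Finset (Vertex k)} (A : Matrix s s ℂ) : Op k :=
  ∑ i, ∑ j, A i j • unitOp i.1 j.1

/-- The compression of an operator to the span of finitely many `δ_v`, as a matrix. -/
def compression {k : ℕ} (s : Finset (Vertex k)) (Y : Op k) : Matrix s s ℂ :=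
  Matrix.of fun i j => Y (lp.single 2 j.1 1) i.1

theorem matOp_mul_mul_matOp {k : ℕ} {s : Finset (Vertex k)} (A B : Matrix s s ℂ) (Y : Op k) :
    matOp A * Y * matOp B = matOp (A * compression s Y * B) := by
  simp only [matOp, compression, Finset.sum_mul, Finset.mul_sum, smul_mul_assoc, mul_smul_comm,
    unitOp_mul_mul_unitOp, smul_smul, Matrix.mul_apply, Matrix.of_apply, Finset.sum_smul,
    Finset.smul_sum]
  refine (Finset.sum_congr rfl fun _ _ => Finset.sum_comm).trans (Finset.sum_comm.trans
    (Finset.sum_congr rfl fun _ _ => Finset.sum_comm.trans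
      (Finset.sum_congr rfl fun _ _ => Finset.sum_congr rfl fun _ _ =>
        Finset.sum_congr rfl fun _ _ => ?_)))
  ring_nf

theorem matOp_add {k : ℕ} {s : Finset (Vertex k)} (A B : Matrix s s ℂ) :
    matOp (A + B) = matOp A + matOp B := by
  simp [matOp, add_smul, Finset.sum_add_distrib]

theorem matOp_smul {k : ℕ} {s : Finset (Vertex k)} (c : ℂ) (A : Matrix s s ℂ) :
    matOp (c • A) = c • matOp A := by
  simp [matOp, mul_smul, Finset.smul_sum]

theorem matOp_one_apply {k : ℕ} (s : Finset (Vertex k)) (φ : Ell2 k) (v : Vertex k) :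
    matOp (1 : Matrix s s ℂ) φ v = if v ∈ s then φ v else 0 := by
  have h : matOp (1 : Matrix s s ℂ) = ∑ i : s, unitOp i.1 i.1 := by
    simp [matOp, Matrix.one_apply]
  rw [h, sum_apply, lp.coeFn_sum, Finset.sum_apply,
    Finset.sum_coe_sort s (fun i => unitOp i i φ v)]
  simp [unitOp_apply, Pi.single_apply]

theorem differentiableOn_det {n : Type*} [Fintype n] [DecidableEq n] {A : ℂ → Matrix n n ℂ}
    {U : Set ℂ} (hA : ∀ i j, DifferentiableOn ℂ (fun t => A t i j) U) :
    DifferentiableOn ℂ (fun t => (A t).det) U := by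
  simp only [Matrix.det_apply]
  refine DifferentiableOn.fun_sum fun σ _ => DifferentiableOn.fun_const_smul ?_ _
  exact DifferentiableOn.fun_finsetProd fun i _ => hA _ _

theorem differentiableOn_adjugate {n : Type*} [Fintype n] [DecidableEq n] {A : ℂ → Matrix n n ℂ}
    {U : Set ℂ} (hA : ∀ i j, DifferentiableOn ℂ (fun t => A t i j) U) (i j : n) :
    DifferentiableOn ℂ (fun t => (A t).adjugate i j) U := by
  simp only [Matrix.adjugate_apply]
  refine differentiableOn_det fun a b => ?_
  simp only [Matrix.updateRow_apply]
  split_ifs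
  · exact differentiableOn_const _
  · exact hA a b

/-- With `P` the projection onto the span of `s` and `A` the matrix of `1 + P Y P` there, the
inverse of `1 + P Y` is `1 - A⁻¹ Y`. Multiplying by `det A` replaces `A⁻¹` by the adjugate, so the
identities stay holomorphic and valid even where `det A = 0`. -/
theorem exists_det_finite_rank {k : ℕ} (s : Finset (Vertex k)) {Y : ℂ → Op k} {U : Set ℂ}
    (hY : DifferentiableOn ℂ Y U) :
    ∃ (d : ℂ → ℂ) (N : ℂ → Op k), DifferentiableOn ℂ d U ∧ DifferentiableOn ℂ N U ∧
      (∀ t, Y t = 0 → d t = 1) ∧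
      ∀ t, (1 + matOp (1 : Matrix s s ℂ) * Y t) * N t = d t • 1 ∧
        N t * (1 + matOp (1 : Matrix s s ℂ) * Y t) = d t • 1 := by
  set P : Op k := matOp (1 : Matrix s s ℂ)
  let A : ℂ → Matrix s s ℂ := fun t => 1 + compression s (Y t)
  have hA : ∀ i j, DifferentiableOn ℂ (fun t => A t i j) U := fun i j => by
    have : DifferentiableOn ℂ (fun t => (lp.evalCLM ℂ (fun _ : Vertex k => ℂ) 2 i.1)
        (Y t (lp.single 2 j.1 1))) U := by fun_prop
    exact this.const_add _
  refine ⟨fun t => (A t).det, fun t => (A t).det • 1 - matOp (A t).adjugate * Y t,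
    differentiableOn_det hA, ?_, fun t ht => ?_, fun t => ?_⟩
  · refine DifferentiableOn.sub ((differentiableOn_det hA).smul_const _)
      (DifferentiableOn.mul ?_ hY)
    exact DifferentiableOn.fun_sum fun i _ => DifferentiableOn.fun_sum fun j _ =>
      (differentiableOn_adjugate hA i j).smul_const _
  · have : compression s (0 : Op k) = 0 := by ext i j; simp [compression]
    simp [A, ht, this]
  · have h1 : matOp (A t).adjugate + P * Y t * matOp (A t).adjugate = (A t).det • P := by
      rw [matOp_mul_mul_matOp, ← matOp_add, one_mul, ← one_add_mul, Matrix.mul_adjugate,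
        matOp_smul]
    have h2 : matOp (A t).adjugate + matOp (A t).adjugate * Y t * P = (A t).det • P := by
      rw [matOp_mul_mul_matOp, ← matOp_add, mul_one, ← mul_one_add, Matrix.adjugate_mul,
        matOp_smul]
    constructor
    · calc (1 + P * Y t) * ((A t).det • 1 - matOp (A t).adjugate * Y t)
          = (A t).det • 1 + (A t).det • P * Y t
            - (matOp (A t).adjugate + P * Y t * matOp (A t).adjugate) * Y t := by
              simp only [mul_sub, add_mul, one_mul, mul_smul_comm, mul_one, smul_add,
                smul_mul_assoc, mul_assoc]
        _ = _ := by rw [h1, add_sub_cancel_right]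
    · calc ((A t).det • 1 - matOp (A t).adjugate * Y t) * (1 + P * Y t)
          = (A t).det • 1 + (A t).det • P * Y t
            - (matOp (A t).adjugate + matOp (A t).adjugate * Y t * P) * Y t := by
              simp only [sub_mul, mul_add, add_mul, one_mul, mul_one,
                smul_mul_assoc, mul_assoc]
              abel
        _ = _ := by rw [h2, add_sub_cancel_right]

/-! ### Holomorphic families of compact perturbations of the identity -/

theorem exists_finset_approx_weight {k : ℕ} {δ : ℝ} (hδ : 0 < δ) {c : ℝ} (hc : 0 < c) :
    ∃ s : Finset (Vertex k),
      ‖wOp k δ * wOp k δ - matOp (1 : Matrix s s ℂ) * (wOp k δ * wOp k δ)‖ ≤ c := by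
  have hw := norm_weight_le (k := k) hδ
  have hw2 : ∀ v : Vertex k, ‖weight δ v * weight δ v‖ = Real.exp (-δ) ^ v.length := fun v => by
    rw [norm_mul, norm_weight, ← Real.exp_add, ← Real.exp_nat_mul]
    ring_nf
  have hw2' : ∀ v : Vertex k, ‖weight δ v * weight δ v‖ ≤ 1 := fun v => by
    rw [hw2]
    exact pow_le_one₀ (Real.exp_pos _).le (Real.exp_le_one_iff.2 (by linarith))
  obtain ⟨n, hn⟩ := exists_pow_lt_of_lt_one hc (Real.exp_lt_one_iff.2 (neg_lt_zero.2 hδ))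
  -- Off the ball of radius `n`, which is finite, `e₋²` is at most `exp(-δ n) < c`.
  let s : Finset (Vertex k) := (List.finite_length_lt (Fin k) n).toFinset
  refine ⟨s, ?_⟩
  let f : Vertex k → ℂ := fun v => if v ∈ s then 0 else weight δ v * weight δ v
  have hf : ∀ v, ‖f v‖ ≤ c := fun v => by
    by_cases hv : v ∈ s
    · simp [f, hv, hc.le]
    · simp only [f, hv, if_false, hw2]
      have : n ≤ v.length := by simpa [s] using hv
      exact (pow_le_pow_of_le_one (Real.exp_pos _).le
        (Real.exp_le_one_iff.2 (by linarith)) this).trans hn.le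
  have : wOp k δ * wOp k δ - matOp (1 : Matrix s s ℂ) * (wOp k δ * wOp k δ) = mulOp f := by
    rw [mulOp_mul hw hw]
    ext φ v
    rw [sub_apply, lp.coeFn_sub, Pi.sub_apply, mul_apply_eq_comp, matOp_one_apply,
      mulOp_apply (bddAbove_norm hw2'), mulOp_apply (bddAbove_norm hf)]
    by_cases hv : v ∈ s <;> simp [f, hv]
  rw [this]
  exact norm_mulOp_le hf

/-- Analytic Fredholm theory: the uniform bound `C` lets one finite set `s` serve all `t ∈ U`, so
that a single determinant works on the whole of `U`. -/
theorem exists_det_weight_mul {k : ℕ} {δ : ℝ} (hδ : 0 < δ) {H : ℂ → Op k} {U : Set ℂ} {C : ℝ}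
    (hH : DifferentiableOn ℂ H U) (hC : ∀ t ∈ U, ‖H t‖ ≤ C) :
    ∃ (d : ℂ → ℂ) (N : ℂ → Op k), DifferentiableOn ℂ d U ∧ DifferentiableOn ℂ N U ∧
      (∀ t, H t = 0 → d t = 1) ∧
      ∀ t ∈ U, (1 + wOp k δ * wOp k δ * H t) * N t = d t • 1 ∧
        N t * (1 + wOp k δ * wOp k δ * H t) = d t • 1 := by
  -- This constant makes `‖S * H t‖ < 1`, so that `1 + S * H t` is inverted by a Neumann series.
  obtain ⟨s, hs⟩ := exists_finset_approx_weight (k := k) hδ (c := (2 * (|C| + 1))⁻¹)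
    (by positivity)
  set E := wOp k δ * wOp k δ
  set P : Op k := matOp (1 : Matrix s s ℂ)
  set S := E - P * E
  have hu : ∀ t ∈ U, IsUnit (1 + S * H t) := fun t ht => by
    have h : ‖-(S * H t)‖ < 1 := by
      rw [norm_neg]
      calc ‖S * H t‖ ≤ ‖S‖ * ‖H t‖ := norm_mul_le _ _
        _ ≤ (2 * (|C| + 1))⁻¹ * |C| := by
          gcongr
          exact (hC t ht).trans (le_abs_self C)
        _ < 1 := by
          rw [inv_mul_lt_one₀ (by positivity)]
          linarith [abs_nonneg C]
    simpa using isUnit_one_sub_of_norm_lt_one h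
  have hX : DifferentiableOn ℂ (fun t => Ring.inverse (1 + S * H t)) U := fun t ht =>
    DifferentiableWithinAt.inverse (((differentiableOn_const S).mul hH).const_add 1 t ht) (hu t ht)
  obtain ⟨d, N, hd, hN, h1, h2⟩ := exists_det_finite_rank s
    (Y := fun t => E * H t * Ring.inverse (1 + S * H t))
    (((differentiableOn_const E).mul hH).mul hX)
  refine ⟨d, fun t => Ring.inverse (1 + S * H t) * N t, hd, hX.mul hN,
    fun t ht => h1 t (by simp [ht]), fun t ht => ?_⟩
  -- Since `E = S + P * E`, the invertible factor `1 + S * H t` splits off and leaves a finite rank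
  -- perturbation of `1`.
  have h3 : 1 + E * H t =
      (1 + P * (E * H t * Ring.inverse (1 + S * H t))) * (1 + S * H t) := by
    rw [add_mul, mul_assoc P, mul_assoc (E * H t), Ring.inverse_mul_cancel _ (hu t ht)]
    simp only [S, sub_mul, one_mul, mul_one, mul_assoc]
    abel
  constructor
  · rw [h3, mul_assoc, Ring.mul_inverse_cancel_left _ _ (hu t ht)]
    exact (h2 t).1
  · rw [h3, mul_assoc, ← mul_assoc (N t), (h2 t).2, smul_mul_assoc, one_mul, mul_smul_comm,
      Ring.inverse_mul_cancel _ (hu t ht)]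

theorem ringInverse_eq {R : Type*} [MonoidWithZero R] {a b : R} (h₁ : a * b = 1)
    (h₂ : b * a = 1) : Ring.inverse a = b :=
  Ring.inverse_unit ⟨a, b, h₁, h₂⟩

/-! ### The free resolvent -/

theorem isUnit_one_sub_smul {k : ℕ} {A : Op k} (hA : ‖A‖ ≤ √(k : ℝ)) {c : ℂ}
    (hc : ‖c‖ * √(k : ℝ) < 1) : IsUnit (1 - c • A) := by
  refine isUnit_one_sub_of_norm_lt_one (lt_of_le_of_lt ?_ hc)
  rw [norm_smul]
  gcongr

/-- `(1 - c U)⁻¹`. -/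
def pullInv (k : ℕ) (c : ℂ) : Op k := Ring.inverse (1 - c • pullOp k)

/-- `(1 - c D)⁻¹`. -/
def pushInv (k : ℕ) (c : ℂ) : Op k := Ring.inverse (1 - c • pushOp k)

theorem pullInv_mul_cancel {k : ℕ} {c : ℂ} (hc : ‖c‖ * √(k : ℝ) < 1) :
    pullInv k c * (1 - c • pullOp k) = 1 :=
  Ring.inverse_mul_cancel _ (isUnit_one_sub_smul (norm_pullOp_le k) hc)

theorem mul_pullInv_cancel {k : ℕ} {c : ℂ} (hc : ‖c‖ * √(k : ℝ) < 1) :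
    (1 - c • pullOp k) * pullInv k c = 1 :=
  Ring.mul_inverse_cancel _ (isUnit_one_sub_smul (norm_pullOp_le k) hc)

theorem pushInv_mul_cancel {k : ℕ} {c : ℂ} (hc : ‖c‖ * √(k : ℝ) < 1) :
    pushInv k c * (1 - c • pushOp k) = 1 :=
  Ring.inverse_mul_cancel _ (isUnit_one_sub_smul (norm_pushOp_le k) hc)

theorem mul_pushInv_cancel {k : ℕ} {c : ℂ} (hc : ‖c‖ * √(k : ℝ) < 1) :
    (1 - c • pushOp k) * pushInv k c = 1 :=
  Ring.mul_inverse_cancel _ (isUnit_one_sub_smul (norm_pushOp_le k) hc)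

theorem differentiableAt_pullInv {k : ℕ} {c : ℂ} (hc : ‖c‖ * √(k : ℝ) < 1) :
    DifferentiableAt ℂ (pullInv k) c :=
  DifferentiableAt.inverse (h := fun c : ℂ => 1 - c • pullOp k) (by fun_prop)
    (isUnit_one_sub_smul (norm_pullOp_le k) hc)

theorem differentiableAt_pushInv {k : ℕ} {c : ℂ} (hc : ‖c‖ * √(k : ℝ) < 1) :
    DifferentiableAt ℂ (pushInv k) c :=
  DifferentiableAt.inverse (h := fun c : ℂ => 1 - c • pushOp k) (by fun_prop)
    (isUnit_one_sub_smul (norm_pushOp_le k) hc)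

/-- Expanding the product, the cross term `t² D U` is the scalar `k t²`. -/
theorem freeOp_sub {k : ℕ} {t : ℂ} (ht : t ≠ 0) :
    freeOp k - algebraMap ℂ (Op k) (k + 1 - k * t - t⁻¹) =
      t⁻¹ • ((1 - t • pushOp k) * (1 - t • pullOp k)) := by
  rw [freeOp, adjOp_eq, sub_mul, one_mul, mul_sub, mul_one, smul_mul_smul_comm,
    pushOp_mul_pullOp]
  simp only [Algebra.algebraMap_eq_smul_one, smul_sub, smul_smul]
  have h : t⁻¹ * (t * t * k) = k * t := by field_simp
  rw [inv_mul_cancel₀ ht, ← mul_assoc] at *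
  rw [h]
  module

theorem freeOp_sub_mul {k : ℕ} {t : ℂ} (ht : t ≠ 0) (h : ‖t‖ * √(k : ℝ) < 1) :
    (freeOp k - algebraMap ℂ (Op k) (k + 1 - k * t - t⁻¹)) *
      (t • (pullInv k t * pushInv k t)) = 1 := by
  rw [freeOp_sub ht, smul_mul_smul_comm, inv_mul_cancel₀ ht, one_smul, mul_assoc,
    ← mul_assoc (1 - t • pullOp k), mul_pullInv_cancel h, one_mul, mul_pushInv_cancel h]

theorem mul_freeOp_sub {k : ℕ} {t : ℂ} (ht : t ≠ 0) (h : ‖t‖ * √(k : ℝ) < 1) :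
    (t • (pullInv k t * pushInv k t)) *
      (freeOp k - algebraMap ℂ (Op k) (k + 1 - k * t - t⁻¹)) = 1 := by
  rw [freeOp_sub ht, smul_mul_smul_comm, mul_inv_cancel₀ ht, one_smul, mul_assoc,
    ← mul_assoc (pushInv k t), pushInv_mul_cancel h, one_mul, pullInv_mul_cancel h]

theorem res_freeOp {k : ℕ} {t : ℂ} (ht : t ≠ 0) (h : ‖t‖ * √(k : ℝ) < 1) :
    res (freeOp k) (k + 1 - k * t - t⁻¹) = t • (pullInv k t * pushInv k t) :=
  ringInverse_eq (freeOp_sub_mul ht h) (mul_freeOp_sub ht h)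

/-- The decay factor `exp(-δ/2)` of the weight. -/
def decay (δ : ℝ) : ℂ := (Real.exp (-(δ / 2)) : ℝ)

theorem norm_decay (δ : ℝ) : ‖decay δ‖ = Real.exp (-(δ / 2)) := by
  rw [decay, Complex.norm_real, Real.norm_of_nonneg (Real.exp_pos _).le]

theorem norm_mul_decay_lt {δ : ℝ} (hδ : 0 < δ) {k : ℕ} {t : ℂ} (h : ‖t‖ * √(k : ℝ) < 1) :
    ‖t * decay δ‖ * √(k : ℝ) < 1 := by
  refine lt_of_le_of_lt ?_ h
  rw [norm_mul, norm_decay]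
  gcongr
  exact mul_le_of_le_one_right (norm_nonneg _) (Real.exp_le_one_iff.2 (by linarith))

/-- The holomorphic extension of the weighted free resolvent, as a function of `t`, the spectral
parameter being `k + 1 - k t - t⁻¹`. -/
def extRes (k : ℕ) (δ : ℝ) (t : ℂ) : Op k :=
  t • (pullInv k (t * decay δ) * (wOp k δ * wOp k δ) * pushInv k (t * decay δ))

/-- The left side needs `|t| √k < 1`; the inverse on the right exists for `|t| √k < exp(δ/2)`, which
yields the continuation. -/
theorem wOp_mul_pullInv {k : ℕ} {δ : ℝ} (hδ : 0 < δ) {t : ℂ} (h : ‖t‖ * √(k : ℝ) < 1) :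
    wOp k δ * pullInv k t = pullInv k (t * decay δ) * wOp k δ := by
  have h1 : wOp k δ * (1 - t • pullOp k) = (1 - (t * decay δ) • pullOp k) * wOp k δ := by
    rw [mul_sub, sub_mul, mul_smul_comm, wOp_mul_pullOp k hδ, smul_smul, smul_mul_assoc, mul_one,
      one_mul, decay]
  calc wOp k δ * pullInv k t
      = pullInv k (t * decay δ) * ((1 - (t * decay δ) • pullOp k) * wOp k δ) * pullInv k t := by
        rw [← mul_assoc, pullInv_mul_cancel (norm_mul_decay_lt hδ h), one_mul]
    _ = _ := by rw [← h1, mul_assoc, mul_assoc, mul_pullInv_cancel h, mul_one]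

theorem pushInv_mul_wOp {k : ℕ} {δ : ℝ} (hδ : 0 < δ) {t : ℂ} (h : ‖t‖ * √(k : ℝ) < 1) :
    pushInv k t * wOp k δ = wOp k δ * pushInv k (t * decay δ) := by
  have h1 : (1 - t • pushOp k) * wOp k δ = wOp k δ * (1 - (t * decay δ) • pushOp k) := by
    rw [mul_sub, sub_mul, smul_mul_assoc, pushOp_mul_wOp k hδ, smul_smul, mul_smul_comm, mul_one,
      one_mul, decay]
  calc pushInv k t * wOp k δ
      = pushInv k t * (wOp k δ * (1 - (t * decay δ) • pushOp k)) * pushInv k (t * decay δ) := by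
        rw [mul_assoc, mul_assoc, mul_pushInv_cancel (norm_mul_decay_lt hδ h), mul_one]
    _ = _ := by rw [← h1, ← mul_assoc, pushInv_mul_cancel h, one_mul]

theorem wOp_mul_res_mul_wOp {k : ℕ} {δ : ℝ} (hδ : 0 < δ) {t : ℂ} (ht : t ≠ 0)
    (h : ‖t‖ * √(k : ℝ) < 1) :
    wOp k δ * res (freeOp k) (k + 1 - k * t - t⁻¹) * wOp k δ = extRes k δ t := by
  rw [res_freeOp ht h, mul_smul_comm, smul_mul_assoc, ← mul_assoc, wOp_mul_pullInv hδ h,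
    mul_assoc, pushInv_mul_wOp hδ h, extRes]
  simp only [mul_assoc]

theorem differentiableAt_extRes {k : ℕ} {δ : ℝ} {t : ℂ} (h : ‖t * decay δ‖ * √(k : ℝ) < 1) :
    DifferentiableAt ℂ (extRes k δ) t := by
  have h1 : DifferentiableAt ℂ (fun t => pullInv k (t * decay δ)) t :=
    DifferentiableAt.comp (g := pullInv k) t (differentiableAt_pullInv h) (by fun_prop)
  have h2 : DifferentiableAt ℂ (fun t => pushInv k (t * decay δ)) t :=
    DifferentiableAt.comp (g := pushInv k) t (differentiableAt_pushInv h) (by fun_prop)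
  exact differentiableAt_id.smul ((h1.mul_const _).mul h2)

theorem exists_det_extRes {k : ℕ} {δ : ℝ} (hδ : 0 < δ) (B : Op k) {ρ : ℝ}
    (hρ : ρ * Real.exp (-(δ / 2)) * √(k : ℝ) < 1) :
    ∃ (d : ℂ → ℂ) (N : ℂ → Op k), DifferentiableOn ℂ d (Metric.ball 0 ρ) ∧
      DifferentiableOn ℂ N (Metric.ball 0 ρ) ∧ d 0 = 1 ∧
      ∀ t ∈ Metric.ball (0 : ℂ) ρ, (1 + extRes k δ t * B) * N t = d t • 1 ∧
        N t * (1 + extRes k δ t * B) = d t • 1 := by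
  have hs : ∀ t ∈ Metric.closedBall (0 : ℂ) ρ, ‖t * decay δ‖ * √(k : ℝ) < 1 := fun t ht => by
    refine lt_of_le_of_lt ?_ hρ
    rw [norm_mul, norm_decay]
    gcongr
    simpa using ht
  let X : ℂ → Op k := fun t => pullInv k (t * decay δ)
  let Y : ℂ → Op k := fun t => pushInv k (t * decay δ)
  have hX : DifferentiableOn ℂ X (Metric.closedBall 0 ρ) := fun t ht =>
    (DifferentiableAt.comp (g := pullInv k) t (differentiableAt_pullInv (hs t ht))
      (by fun_prop)).differentiableWithinAt
  have hY : DifferentiableOn ℂ Y (Metric.closedBall 0 ρ) := fun t ht =>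
    (DifferentiableAt.comp (g := pushInv k) t (differentiableAt_pushInv (hs t ht))
      (by fun_prop)).differentiableWithinAt
  have hH : DifferentiableOn ℂ (fun t => t • (Y t * B * X t)) (Metric.closedBall 0 ρ) :=
    differentiableOn_id.smul ((hY.mul_const B).mul hX)
  obtain ⟨C, hC⟩ := (isCompact_closedBall (0 : ℂ) ρ).exists_bound_of_continuousOn hH.continuousOn
  have hsub := Metric.ball_subset_closedBall (x := (0 : ℂ)) (ε := ρ)
  obtain ⟨d, N, hd, hN, h0, h1⟩ := exists_det_weight_mul hδ (hH.mono hsub)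
    fun t ht => hC t (hsub ht)
  refine ⟨d, fun t => X t * N t * (1 - (t * decay δ) • pullOp k), hd,
    ((hX.mono hsub).mul hN).mul (by fun_prop), h0 0 (by simp), fun t ht => ?_⟩
  have hX1 : X t * (1 - (t * decay δ) • pullOp k) = 1 := pullInv_mul_cancel (hs t (hsub ht))
  have hX2 : (1 - (t * decay δ) • pullOp k) * X t = 1 := mul_pullInv_cancel (hs t (hsub ht))
  set Z := 1 - (t * decay δ) • pullOp k
  set A := 1 + wOp k δ * wOp k δ * (t • (Y t * B * X t)) with hA
  obtain ⟨h2, h3⟩ := h1 t ht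
  -- Conjugation by `X t`, whose inverse is `Z`, moves `e₋²` to the far left, the form required by
  -- `exists_det_weight_mul`.
  have h4 : 1 + extRes k δ t * B = X t * A * Z := by
    have : extRes k δ t = t • (X t * (wOp k δ * wOp k δ) * Y t) := rfl
    rw [hA, this, mul_add, mul_one, add_mul, hX1, mul_smul_comm, mul_smul_comm, smul_mul_assoc,
      smul_mul_assoc]
    congr 2
    simp only [mul_assoc, hX1, mul_one]
  rw [h4]
  constructor
  · calc X t * A * Z * (X t * N t * Z) = X t * A * (Z * X t) * N t * Z := by
          simp only [mul_assoc]
      _ = X t * (A * N t) * Z := by rw [hX2]; simp only [mul_assoc, one_mul]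
      _ = _ := by rw [h2, mul_smul_comm, mul_one, smul_mul_assoc, hX1]
  · calc X t * N t * Z * (X t * A * Z) = X t * N t * (Z * X t) * A * Z := by
          simp only [mul_assoc]
      _ = X t * (N t * A) * Z := by rw [hX2]; simp only [mul_assoc, one_mul]
      _ = _ := by rw [h3, mul_smul_comm, mul_one, smul_mul_assoc, hX1]

/-! ### The perturbed resolvent -/

theorem isUnit_one_add_mul_comm {R : Type*} [Ring R] {a b : R} (h : IsUnit (1 + a * b)) :
    IsUnit (1 + b * a) := by
  obtain ⟨u, hu⟩ := h
  have h1 : (1 + a * b) * (↑u⁻¹ : R) = 1 := by rw [← hu, u.mul_inv]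
  have h2 : (↑u⁻¹ : R) * (1 + a * b) = 1 := by rw [← hu, u.inv_mul]
  refine ⟨⟨1 + b * a, 1 - b * ↑u⁻¹ * a, ?_, ?_⟩, rfl⟩
  · calc (1 + b * a) * (1 - b * ↑u⁻¹ * a) = 1 + b * a - b * ((1 + a * b) * ↑u⁻¹) * a := by
          noncomm_ring
      _ = 1 := by rw [h1]; noncomm_ring
  · calc (1 - b * ↑u⁻¹ * a) * (1 + b * a) = 1 + b * a - b * (↑u⁻¹ * (1 + a * b)) * a := by
          noncomm_ring
      _ = 1 := by rw [h2]; noncomm_ring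

/-- Only the weighted resolvent `E G E` enters on the right, and that is the quantity that extends.
-/
theorem isUnit_add_mul_mul_iff {R : Type*} [Ring R] {F G E B : R} (h₁ : F * G = 1)
    (h₂ : G * F = 1) : IsUnit (F + E * B * E) ↔ IsUnit (1 + E * G * E * B) := by
  have hF : IsUnit F := ⟨⟨F, G, h₁, h₂⟩, rfl⟩
  have h3 : F + E * B * E = F * (1 + G * E * B * E) := by
    rw [mul_add, mul_one, ← mul_assoc, ← mul_assoc, ← mul_assoc, h₁, one_mul]
  rw [h3, hF.mul_left_iff]
  constructor <;> intro h
  · simpa only [mul_assoc] using isUnit_one_add_mul_comm h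
  · exact isUnit_one_add_mul_comm (by simpa only [mul_assoc] using h)

/-- The second resolvent identity `A + G (E B E) A = G`, multiplied by `E` on both sides. -/
theorem mul_inverse_add_mul_mul {R : Type*} [Ring R] {F G E B : R} (h₁ : F * G = 1)
    (h₂ : G * F = 1) (h : IsUnit (F + E * B * E)) :
    E * Ring.inverse (F + E * B * E) * E = Ring.inverse (1 + E * G * E * B) * (E * G * E) := by
  have hu := (isUnit_add_mul_mul_iff h₁ h₂).1 h
  set A := Ring.inverse (F + E * B * E) with hA
  have h3 : A + G * E * B * E * A = G := by
    calc A + G * E * B * E * A = G * ((F + E * B * E) * A) + (1 - G * F) * A := by noncomm_ring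
      _ = G := by rw [hA, Ring.mul_inverse_cancel _ h, h₂]; simp
  have h4 : (1 + E * G * E * B) * (E * A * E) = E * G * E := by
    calc (1 + E * G * E * B) * (E * A * E) = E * (A + G * E * B * E * A) * E := by noncomm_ring
      _ = _ := by rw [h3]
  rw [← Ring.inverse_mul_cancel_left _ (E * A * E) hu, h4]

/-! ### The spectral parameter -/

/-- The root `x = √(1 - w²/4) + i w/2` has inverse `√(1 - w²/4) - i w/2`. Positivity of `Re x`
singles it out from the other root `-x⁻¹`. -/
theorem exists_branch {b : ℝ} (hb : 1 < b) :
    ∃ ε > 0, ∃ x : ℂ → ℂ, DifferentiableOn ℂ x (Metric.ball 0 ε) ∧ x 0 = 1 ∧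
      ∀ w ∈ Metric.ball (0 : ℂ) ε, x w ≠ 0 ∧ x w - (x w)⁻¹ = Complex.I * w ∧ 0 < (x w).re ∧
        ‖x w‖ < b := by
  let s : ℂ → ℂ := fun w => (1 - w ^ 2 / 4) ^ (1 / 2 : ℂ)
  let x : ℂ → ℂ := fun w => s w + Complex.I * w / 2
  have hs (w : ℂ) : s w ^ 2 = 1 - w ^ 2 / 4 := by
    have : (1 / 2 : ℂ) = ((2 : ℕ) : ℂ)⁻¹ := by norm_num
    simp only [s]
    rw [this, Complex.cpow_nat_inv_pow _ two_ne_zero]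
  have hxy (w : ℂ) : x w * (s w - Complex.I * w / 2) = 1 := by
    linear_combination hs w - w ^ 2 / 4 * Complex.I_sq
  have hslit : ∀ᶠ w in 𝓝 (0 : ℂ), 1 - w ^ 2 / 4 ∈ Complex.slitPlane := by
    have : ContinuousAt (fun w : ℂ => 1 - w ^ 2 / 4) 0 := by fun_prop
    exact this.eventually_mem (Complex.isOpen_slitPlane.mem_nhds (by simp))
  have hd : ∀ w, 1 - w ^ 2 / 4 ∈ Complex.slitPlane → DifferentiableAt ℂ x w := fun w hw =>
    have h1 : DifferentiableAt ℂ (fun w : ℂ => 1 - w ^ 2 / 4) w := by fun_prop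
    have h2 : DifferentiableAt ℂ (fun w : ℂ => Complex.I * w / 2) w := by fun_prop
    (h1.cpow_const hw).add h2
  have hx0 : x 0 = 1 := by simp [x, s]
  have hx : ContinuousAt x 0 := (hd 0 (by simp)).continuousAt
  have hre : ∀ᶠ w in 𝓝 (0 : ℂ), 0 < (x w).re :=
    (Complex.continuous_re.continuousAt.comp hx).eventually
      (lt_mem_nhds (by simp [hx0]))
  have hnorm : ∀ᶠ w in 𝓝 (0 : ℂ), ‖x w‖ < b :=
    hx.norm.eventually (gt_mem_nhds (by simpa [hx0] using hb))
  obtain ⟨ε, hε, h⟩ := Metric.eventually_nhds_iff_ball.1 (hslit.and (hre.and hnorm))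
  refine ⟨ε, hε, x, fun w hw => (hd w (h w hw).1).differentiableWithinAt, hx0, fun w hw =>
    ⟨left_ne_zero_of_mul_eq_one (hxy w), ?_, (h w hw).2.1, (h w hw).2.2⟩⟩
  rw [← eq_inv_of_mul_eq_one_right (hxy w)]
  simp only [x]
  ring

/-- The real part of the equation reads `Re x (1 - |x|⁻²) = -Im w < 0`. -/
theorem norm_lt_one_of_sub_inv_eq {x w : ℂ} (hx : x - x⁻¹ = Complex.I * w) (hre : 0 < x.re)
    (hw : 0 < w.im) : ‖x‖ < 1 := by
  have h := congrArg Complex.re hx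
  rw [Complex.sub_re, Complex.inv_re, Complex.I_mul_re] at h
  by_contra! hle
  have h1 : 1 ≤ Complex.normSq x := by
    rw [Complex.normSq_eq_norm_sq]
    exact one_le_pow₀ hle
  have h2 : x.re / Complex.normSq x ≤ x.re := div_le_self hre.le h1
  linarith

/-- There are `ε > 0` and a parametrization `z = k + 1 - k t - t⁻¹` of the spectral parameter
`z = t₋(k) + √k w²` by a holomorphic function `t = τ(w)`, `|w| < ε`. -/
theorem exists_param {k : ℕ} (hk : 1 ≤ k) {ρ : ℝ} (hρ : 1 < ρ * √(k : ℝ)) :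
    ∃ ε > 0, ∃ τ : ℂ → ℂ, DifferentiableOn ℂ τ (Metric.ball 0 ε) ∧
      Set.InjOn τ (Metric.ball 0 ε) ∧
      ∀ w ∈ Metric.ball (0 : ℂ) ε, τ w ≠ 0 ∧ τ w ∈ Metric.ball (0 : ℂ) ρ ∧
        zMinus k w = k + 1 - k * τ w - (τ w)⁻¹ ∧ (0 < w.im → ‖τ w‖ * √(k : ℝ) < 1) := by
  have hb : 1 < √(ρ * √(k : ℝ)) := by rwa [Real.lt_sqrt zero_le_one, one_pow]
  obtain ⟨ε, hε, x, hx, -, h⟩ := exists_branch hb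
  have hk0 : 0 < √(k : ℝ) := Real.sqrt_pos.2 (by exact_mod_cast hk)
  have hk0' : ((√(k : ℝ) : ℝ) : ℂ) ≠ 0 := by exact_mod_cast hk0.ne'
  have hkk : ((√(k : ℝ) : ℝ) : ℂ) ^ 2 = k := by
    rw [← Complex.ofReal_pow, Real.sq_sqrt (Nat.cast_nonneg k), Complex.ofReal_natCast]
  have hn (w : ℂ) : ‖x w ^ 2 / (√(k : ℝ) : ℝ)‖ = ‖x w‖ ^ 2 / √(k : ℝ) := by
    rw [norm_div, norm_pow, Complex.norm_real, Real.norm_of_nonneg hk0.le]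
  -- With `t = x²/√k`, `k t + t⁻¹ = √k (x² + x⁻²) = √k (2 + (x - x⁻¹)²) = 2√k - √k w²`.
  refine ⟨ε, hε, fun w => x w ^ 2 / (√(k : ℝ) : ℝ), (hx.pow 2).div_const _,
    fun w₁ h₁ w₂ h₂ he => ?_, fun w hw => ?_⟩
  · have h3 : x w₁ ^ 2 = x w₂ ^ 2 := by
      simpa [div_left_inj' hk0'] using he
    obtain ⟨-, ha, ha', -⟩ := h w₁ h₁
    obtain ⟨-, hb, hb', -⟩ := h w₂ h₂
    rcases sq_eq_sq_iff_eq_or_eq_neg.1 h3 with h4 | h4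
    · rw [h4, hb] at ha
      exact (mul_left_cancel₀ Complex.I_ne_zero ha).symm
    · rw [h4, Complex.neg_re] at ha'
      linarith
  · obtain ⟨h0, h1, h2, h3⟩ := h w hw
    refine ⟨div_ne_zero (pow_ne_zero 2 h0) hk0', ?_, ?_, fun him => ?_⟩
    · rw [mem_ball_zero_iff, hn, div_lt_iff₀ hk0]
      exact (Real.lt_sqrt (norm_nonneg _)).1 h3
    · have hw2 : w ^ 2 = -(x w - (x w)⁻¹) ^ 2 := by
        rw [h1, mul_pow, Complex.I_sq]
        ring
      rw [zMinus, tMinus, hw2, ← hkk]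
      field_simp
      ring
    · rw [hn, div_mul_cancel₀ _ hk0.ne']
      exact pow_lt_one₀ (norm_nonneg _) (norm_lt_one_of_sub_inv_eq h1 h2 him) two_ne_zero

/-! ### Meromorphic continuation -/

theorem isPreconnected_pdisc {ε : ℝ} (hε : 0 < ε) : IsPreconnected (pdisc ε) := by
  have : pdisc ε = Complex.exp '' {s | s.re < Real.log ε} := by
    ext w
    simp only [pdisc, Set.mem_ofPred_eq, Set.mem_image]
    constructor
    · rintro ⟨h1, h2⟩
      refine ⟨Complex.log w, ?_, Complex.exp_log (norm_pos_iff.1 h1)⟩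
      rw [Complex.log_re]
      exact Real.log_lt_log h1 h2
    · rintro ⟨s, hs, rfl⟩
      rw [Complex.norm_exp]
      exact ⟨Real.exp_pos _, (Real.lt_log_iff_exp_lt hε).1 hs⟩
  rw [this]
  exact ((convex_halfSpace_re_lt _).isPreconnected).image _ Complex.continuous_exp.continuousOn

theorem isOpen_pdisc (ε : ℝ) : IsOpen (pdisc ε) :=
  (isOpen_lt continuous_const continuous_norm).inter (isOpen_lt continuous_norm continuous_const)

/-- Identity theorem: on a preconnected set, infinite order of `f - g` at one point forces it at
every point. -/
theorem eventually_eq_of_meromorphicOn {E : Type*} [NormedAddCommGroup E] [NormedSpace ℂ E]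
    {f g : ℂ → E} {U : Set ℂ} (hU : IsPreconnected U) (hf : MeromorphicOn f U)
    (hg : MeromorphicOn g U) {w₀ w : ℂ} (hw₀ : w₀ ∈ U) (hw : w ∈ U) (h : f =ᶠ[𝓝[≠] w₀] g) :
    f =ᶠ[𝓝[≠] w] g := by
  have hfg : MeromorphicOn (f - g) U := hf.sub hg
  have h0 : meromorphicOrderAt (f - g) w₀ = ⊤ :=
    meromorphicOrderAt_eq_top_iff.2 (h.mono fun z hz => sub_eq_zero.2 hz)
  by_contra hne
  refine hfg.meromorphicOrderAt_ne_top_of_isPreconnected hU hw hw₀ (fun ht => hne ?_) h0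
  exact (meromorphicOrderAt_eq_top_iff.1 ht).mono fun z hz => sub_eq_zero.1 hz

/-! ### Factoring the potential through the weight. -/

theorem norm_weight_sq {k : ℕ} (δ : ℝ) (v : Vertex k) :
    ‖weight δ v‖ ^ 2 = Real.exp (-δ * v.length) := by
  rw [norm_weight, ← Real.exp_nat_mul]
  ring_nf

theorem weight_ne_zero {k : ℕ} (δ : ℝ) (v : Vertex k) : weight δ v ≠ 0 := by
  rw [weight, Complex.ofReal_ne_zero]
  exact (Real.exp_pos _).ne'

/-- `V / e₋²` is bounded because `e₋²` decays at exactly the rate imposed on `V`. -/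
theorem exists_mulOp_eq {k : ℕ} {δ : ℝ} (hδ : 0 < δ) {V : Vertex k → ℂ} {C : ℝ}
    (hV : ∀ v, ‖V v‖ ≤ C * Real.exp (-δ * v.length)) :
    ∃ B : Op k, mulOp V = wOp k δ * B * wOp k δ := by
  have hw := norm_weight_le (k := k) hδ
  have hb : ∀ v, ‖V v / weight δ v ^ 2‖ ≤ C := fun v => by
    rw [norm_div, norm_pow, norm_weight_sq, div_le_iff₀ (Real.exp_pos _)]
    exact hV v
  have hwb : ∀ v, ‖weight δ v * (V v / weight δ v ^ 2)‖ ≤ 1 * C := fun v => by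
    rw [norm_mul]
    exact mul_le_mul (hw v) (hb v) (norm_nonneg _) zero_le_one
  refine ⟨mulOp fun v => V v / weight δ v ^ 2, ?_⟩
  rw [mulOp_mul hw hb, mulOp_mul hwb hw]
  congr 1
  funext v
  field_simp [weight_ne_zero δ v]

theorem exists_mulOp_sqrt_eq {k : ℕ} {δ : ℝ} (hδ : 0 < δ) {V : Vertex k → ℂ} {C : ℝ}
    (hV : ∀ v, ‖V v‖ ≤ C * Real.exp (-δ * v.length)) :
    ∃ B : Op k, mulOp (fun v => ((√‖V v‖ : ℝ) : ℂ)) = wOp k δ * B ∧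
      mulOp (fun v => ((√‖V v‖ : ℝ) : ℂ)) = B * wOp k δ := by
  have hw := norm_weight_le (k := k) hδ
  have hb : ∀ v, ‖((√‖V v‖ : ℝ) : ℂ) / weight δ v‖ ≤ √C := fun v => by
    have hpos : 0 < ‖weight δ v‖ := norm_pos_iff.2 (weight_ne_zero δ v)
    rw [norm_div, Complex.norm_real, Real.norm_of_nonneg (Real.sqrt_nonneg _), div_le_iff₀ hpos,
      ← Real.sqrt_sq hpos.le, norm_weight_sq, ← Real.sqrt_mul' _ (Real.exp_pos _).le]
    exact Real.sqrt_le_sqrt (hV v)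
  refine ⟨mulOp fun v => ((√‖V v‖ : ℝ) : ℂ) / weight δ v, ?_, ?_⟩
  · rw [mulOp_mul hw hb]
    congr 1
    funext v
    rw [mul_div_cancel₀ _ (weight_ne_zero δ v)]
  · rw [mulOp_mul hb hw]
    congr 1
    funext v
    rw [div_mul_cancel₀ _ (weight_ne_zero δ v)]

theorem mem_resolventSet_iff {k : ℕ} (A : Op k) (z : ℂ) :
    z ∈ resolventSet ℂ A ↔ IsUnit (A - algebraMap ℂ (Op k) z) := by
  rw [spectrum.mem_resolventSet_iff, ← IsUnit.neg_iff, neg_sub]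

theorem schrodinger_sub {k : ℕ} {δ : ℝ} {V : Vertex k → ℂ} {B : Op k}
    (hB : mulOp V = wOp k δ * B * wOp k δ) (z : ℂ) :
    schrodinger k V - algebraMap ℂ (Op k) z =
      freeOp k - algebraMap ℂ (Op k) z + wOp k δ * B * wOp k δ := by
  rw [schrodinger, hB]
  abel

theorem mem_resolventSet_schrodinger_iff {k : ℕ} {δ : ℝ} (hδ : 0 < δ) {V : Vertex k → ℂ}
    {B : Op k} (hB : mulOp V = wOp k δ * B * wOp k δ) {t : ℂ} (ht : t ≠ 0)
    (h : ‖t‖ * √(k : ℝ) < 1) :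
    (k + 1 - k * t - t⁻¹ : ℂ) ∈ resolventSet ℂ (schrodinger k V) ↔
      IsUnit (1 + extRes k δ t * B) := by
  rw [mem_resolventSet_iff, schrodinger_sub hB,
    isUnit_add_mul_mul_iff (freeOp_sub_mul ht h) (mul_freeOp_sub ht h), ← res_freeOp ht h,
    wOp_mul_res_mul_wOp hδ ht h]

theorem weightedRes_eq {k : ℕ} {δ : ℝ} (hδ : 0 < δ) {V : Vertex k → ℂ}
    {B : Op k} (hB : mulOp V = wOp k δ * B * wOp k δ) {t : ℂ} (ht : t ≠ 0)
    (h : ‖t‖ * √(k : ℝ) < 1)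
    (hz : (k + 1 - k * t - t⁻¹ : ℂ) ∈ resolventSet ℂ (schrodinger k V)) :
    weightedRes k δ V (k + 1 - k * t - t⁻¹) =
      Ring.inverse (1 + extRes k δ t * B) * extRes k δ t := by
  rw [mem_resolventSet_iff, schrodinger_sub hB] at hz
  rw [weightedRes, res, schrodinger_sub hB,
    mul_inverse_add_mul_mul (freeOp_sub_mul ht h) (mul_freeOp_sub ht h) hz, ← res_freeOp ht h,
    wOp_mul_res_mul_wOp hδ ht h]

theorem sandwich_eq {k : ℕ} {δ : ℝ} (hδ : 0 < δ) {V : Vertex k → ℂ} {B : Op k}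
    (h₁ : mulOp (fun v => ((√‖V v‖ : ℝ) : ℂ)) = wOp k δ * B)
    (h₂ : mulOp (fun v => ((√‖V v‖ : ℝ) : ℂ)) = B * wOp k δ) {t : ℂ} (ht : t ≠ 0)
    (h : ‖t‖ * √(k : ℝ) < 1) :
    sandwich k V (k + 1 - k * t - t⁻¹) =
      mulOp (fun v => V v / ‖V v‖) * B * extRes k δ t * B := by
  rw [← wOp_mul_res_mul_wOp hδ ht h, sandwich]
  nth_rw 1 [h₂]
  rw [h₁]
  simp only [mul_assoc]

/-! ### Existence of the extensions and absence of poles. -/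

/-- The radius `ε` comes from the change of variable alone, hence from `k` and `δ`; `r₀` depends on
`V` through the zeros of `d`. -/
theorem exists_extensions {k : ℕ} (hk : 1 ≤ k) {δ : ℝ} (hδ : 0 < δ) :
    ∃ ε : ℝ, 0 < ε ∧ ∀ V : Vertex k → ℂ, (∃ C : ℝ, ∀ v, ‖V v‖ ≤ C * Real.exp (-δ * v.length)) →
      (∃ R, IsResExtension k δ V (zMinus k) ε R) ∧
      (∃ T, IsSandwichExtension k V (zMinus k) ε T) ∧
      ∃ r₀ : ℝ, 0 < r₀ ∧ r₀ ≤ ε ∧ extensionPoles k δ V (zMinus k) ε ∩ pdisc r₀ = ∅ := by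
  have hk0 : 0 < √(k : ℝ) := Real.sqrt_pos.2 (by exact_mod_cast hk)
  -- The radius `ρ` is the geometric mean of `1/√k` (threshold) and `exp(δ/2)/√k` (limit of
  -- holomorphy).
  have hρ1 : 1 < Real.exp (δ / 4) / √(k : ℝ) * √(k : ℝ) := by
    rw [div_mul_cancel₀ _ hk0.ne', Real.one_lt_exp_iff]
    positivity
  have hρ2 : Real.exp (δ / 4) / √(k : ℝ) * Real.exp (-(δ / 2)) * √(k : ℝ) < 1 := by
    rw [mul_right_comm, div_mul_cancel₀ _ hk0.ne', ← Real.exp_add, Real.exp_lt_one_iff]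
    linarith
  set ρ := Real.exp (δ / 4) / √(k : ℝ)
  have hρ : 0 < ρ := div_pos (Real.exp_pos _) hk0
  obtain ⟨ε, hε, τ, hτ, hinj, h⟩ := exists_param hk hρ1
  have hsub : pdisc ε ⊆ Metric.ball 0 ε := fun w hw => mem_ball_zero_iff.2 hw.2
  have hW : DifferentiableOn ℂ (fun w => extRes k δ (τ w)) (Metric.ball 0 ε) := fun w hw => by
    refine DifferentiableAt.comp_differentiableWithinAt (g := extRes k δ) w
      (differentiableAt_extRes ?_) (hτ w hw)
    refine lt_of_le_of_lt ?_ hρ2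
    rw [norm_mul, norm_decay]
    have := (mem_ball_zero_iff.1 (h w hw).2.1).le
    gcongr
  refine ⟨ε, hε, fun V ⟨C, hV⟩ => ?_⟩
  obtain ⟨B, hB⟩ := exists_mulOp_eq hδ hV
  obtain ⟨S, hS₁, hS₂⟩ := exists_mulOp_sqrt_eq hδ hV
  obtain ⟨d, N, hd, hN, hd0, hdN⟩ := exists_det_extRes hδ B hρ2
  have hdτ : DifferentiableOn ℂ (fun w => d (τ w)) (Metric.ball 0 ε) :=
    hd.comp hτ fun w hw => (h w hw).2.1
  have hNτ : DifferentiableOn ℂ (fun w => N (τ w)) (Metric.ball 0 ε) :=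
    hN.comp hτ fun w hw => (h w hw).2.1
  have hunit : ∀ w ∈ Metric.ball (0 : ℂ) ε, d (τ w) ≠ 0 →
      Ring.inverse (1 + extRes k δ (τ w) * B) = (d (τ w))⁻¹ • N (τ w) ∧
        IsUnit (1 + extRes k δ (τ w) * B) := fun w hw hdw => by
    obtain ⟨h1, h2⟩ := hdN (τ w) (h w hw).2.1
    have h3 : (1 + extRes k δ (τ w) * B) * ((d (τ w))⁻¹ • N (τ w)) = 1 := by
      rw [mul_smul_comm, h1, smul_smul, inv_mul_cancel₀ hdw, one_smul]
    have h4 : ((d (τ w))⁻¹ • N (τ w)) * (1 + extRes k δ (τ w) * B) = 1 := by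
      rw [smul_mul_assoc, h2, smul_smul, inv_mul_cancel₀ hdw, one_smul]
    exact ⟨ringInverse_eq h3 h4, ⟨⟨_, _, h3, h4⟩, rfl⟩⟩
  have hball : ∀ {w : ℂ}, w ∈ Metric.ball (0 : ℂ) ε → ∀ᶠ z in 𝓝 w, z ∈ Metric.ball (0 : ℂ) ε :=
    fun hw => Metric.isOpen_ball.mem_nhds hw
  -- `d 0 = 1` rules out `d` vanishing identically near `τ w`; injectivity of `τ` transfers the
  -- isolation of zeros to `w`.
  have hne : ∀ w ∈ Metric.ball (0 : ℂ) ε, ∀ᶠ z in 𝓝[≠] w, d (τ z) ≠ 0 := fun w hw => by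
    have hdan : AnalyticOnNhd ℂ d (Metric.ball 0 ρ) := hd.analyticOnNhd Metric.isOpen_ball
    have h1 : ∀ᶠ t in 𝓝[≠] (τ w), d t ≠ 0 := by
      refine ((hdan _ (h w hw).2.1).eventually_eq_zero_or_eventually_ne_zero).resolve_left
        fun h0 => ?_
      have := hdan.eqOn_zero_of_preconnected_of_eventuallyEq_zero
        (convex_ball _ _).isPreconnected (h w hw).2.1 h0 (Metric.mem_ball_self hρ)
      simp [hd0] at this
    refine Filter.Tendsto.eventually (f := τ) (tendsto_nhdsWithin_iff.2 ⟨?_, ?_⟩) h1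
    · exact ((hτ.differentiableAt (hball hw)).continuousAt).tendsto.mono_left nhdsWithin_le_nhds
    · filter_upwards [self_mem_nhdsWithin, nhdsWithin_le_nhds (hball hw)] with z hz hz'
      exact fun he => hz (hinj hz' hw he)
  -- At zeros of `d ∘ τ` the value may be the default `0` of `Ring.inverse`; meromorphy only sees
  -- punctured neighbourhoods.
  let R : ℂ → Op k := fun w => Ring.inverse (1 + extRes k δ (τ w) * B) * extRes k δ (τ w)
  have hRmer : ∀ w ∈ Metric.ball (0 : ℂ) ε, MeromorphicAt R w := fun w hw => by
    have h1 : MeromorphicAt (fun w => ((d (τ w))⁻¹ • N (τ w)) * extRes k δ (τ w)) w := by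
      have h2 : AnalyticAt ℂ (fun w => N (τ w) * extRes k δ (τ w)) w :=
        (hNτ.mul hW).analyticAt (hball hw)
      have h3 := ((hdτ.analyticAt (hball hw)).meromorphicAt.inv).smul h2.meromorphicAt
      refine h3.congr (Filter.Eventually.of_forall fun z => ?_)
      simp
    refine h1.congr ?_
    filter_upwards [hne w hw, nhdsWithin_le_nhds (hball hw)] with z hz hz'
    simp only [R, (hunit z hz' hz).1]
  have hR : IsResExtension k δ V (zMinus k) ε R :=
    ⟨fun w hw => hRmer w (hsub hw), fun w hw him hz => by
      obtain ⟨h1, -, h3, h4⟩ := h w (hsub hw)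
      rw [h3] at hz ⊢
      exact (weightedRes_eq hδ hB h1 (h4 him) hz).symm⟩
  refine ⟨⟨R, hR⟩, ⟨fun w => mulOp (fun v => V v / ‖V v‖) * S * extRes k δ (τ w) * S,
    ((hW.mono hsub).const_mul _).mul_const _, fun w hw him => ?_⟩, ?_⟩
  · obtain ⟨h1, -, h3, h4⟩ := h w (hsub hw)
    rw [h3, sandwich_eq hδ hS₁ hS₂ h1 (h4 him)]
  -- The threshold `w = 0` may itself be a zero of `d ∘ τ`; isolation clears a punctured disc around
  -- it.
  obtain ⟨r, hr, hr'⟩ := Metric.eventually_nhds_iff_ball.1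
    (eventually_nhdsWithin_iff.1 (hne 0 (Metric.mem_ball_self hε)))
  refine ⟨min r ε, lt_min hr hε, min_le_right _ _, ?_⟩
  rw [Set.eq_empty_iff_forall_notMem]
  rintro w ⟨⟨hwε, R', hR', hord⟩, hw0, hwr⟩
  have hdw : d (τ w) ≠ 0 := hr' w (mem_ball_zero_iff.2 (hwr.trans_le (min_le_left _ _)))
    (norm_pos_iff.1 hw0)
  have hwb := hsub hwε
  have hRan : AnalyticAt ℂ R w := by
    have h1 : AnalyticAt ℂ (fun w => (d (τ w))⁻¹ • (N (τ w) * extRes k δ (τ w))) w :=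
      ((hdτ.analyticAt (hball hwb)).inv hdw).smul ((hNτ.mul hW).analyticAt (hball hwb))
    refine h1.congr ?_
    filter_upwards [hball hwb, (hdτ.differentiableAt (hball hwb)).continuousAt.eventually_ne hdw]
      with z hz hz'
    simp only [R, (hunit z hz hz').1, smul_mul_assoc]
  -- A pole is defined through an arbitrary extension `R'`. It agrees with `R` near this point of
  -- the upper half disc, hence near `w`, where `R` is analytic.
  let w₀ : ℂ := (ε / 2 : ℝ) * Complex.I
  have hw₀ : w₀ ∈ pdisc ε := by
    have : ‖w₀‖ = ε / 2 := by
      rw [norm_mul, Complex.norm_I, mul_one, Complex.norm_real, Real.norm_of_nonneg (by positivity)]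
    constructor <;> rw [this] <;> linarith
  have him₀ : 0 < w₀.im := by simpa [w₀] using hε
  have heq : R' =ᶠ[𝓝[≠] w₀] R := by
    filter_upwards [hne w₀ (hsub hw₀), nhdsWithin_le_nhds ((isOpen_pdisc ε).mem_nhds hw₀),
      nhdsWithin_le_nhds ((isOpen_lt continuous_const Complex.continuous_im).mem_nhds him₀)]
      with z hz hzε him
    obtain ⟨h1, -, h3, h4⟩ := h z (hsub hzε)
    have hz' : zMinus k z ∈ resolventSet ℂ (schrodinger k V) := by
      rw [h3, mem_resolventSet_schrodinger_iff hδ hB h1 (h4 him)]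
      exact (hunit z (hsub hzε) hz).2
    rw [hR'.eq_weightedRes z hzε him hz', hR.eq_weightedRes z hzε him hz']
  have heq' : R' =ᶠ[𝓝[≠] w] R := eventually_eq_of_meromorphicOn (isPreconnected_pdisc hε)
    hR'.meromorphicOn hR.meromorphicOn hw₀ hwε heq
  rw [meromorphicOrderAt_congr heq'] at hord
  exact hord.not_ge hRan.meromorphicOrderAt_nonneg

/-! ### The two thresholds. -/

theorem norm_tilde_le {k : ℕ} {δ C : ℝ} {M : Vertex k → ℂ}
    (hM : ∀ v, ‖M v‖ ≤ C * Real.exp (-δ * v.length)) (v : Vertex k) :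
    ‖tilde M v‖ ≤ (1 + C) * Real.exp (-δ * v.length) := by
  rw [tilde, add_mul, one_mul]
  refine (norm_add_le _ _).trans (add_le_add ?_ (hM v))
  rw [norm_neg]
  split_ifs with h
  · simp [h]
  · simpa using (Real.exp_pos _).le

theorem two_mul_sub_zPlus (k : ℕ) : (fun w => 2 * ((k : ℂ) + 1) - zPlus k w) = zMinus k := by
  funext w
  rw [zPlus, zMinus, tPlus, tMinus]
  ring

end TreeRes

end

theorem theorem1 (k : ℕ) (hk : 1 ≤ k) (δ : ℝ)
    (hδ : (k = 1 → 0 < δ) ∧ (k ≠ 1 → 6 * Real.log k ≤ δ)) :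
    ∃ ε : ℝ, 0 < ε ∧ ∀ M : Vertex k → ℂ,
      (∃ C : ℝ, ∀ v, ‖M v‖ ≤ C * Real.exp (-δ * v.length)) →
      -- the extensions that define the resonances and their multiplicities exist
      (∃ R, IsResExtension k δ (tilde M) (zMinus k) ε R) ∧
      (∃ R, IsResExtension k δ (-tilde M) (fun w => 2 * ((k : ℂ) + 1) - zPlus k w) ε R) ∧
      (∃ T, IsSandwichExtension k (tilde M) (zMinus k) ε T) ∧
      (∃ T, IsSandwichExtension k (-tilde M) (fun w => 2 * ((k : ℂ) + 1) - zPlus k w) ε T) ∧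
      -- there are no resonances near the thresholds
      ∃ r₀ : ℝ, 0 < r₀ ∧ r₀ ≤ ε ∧ ∀ r : ℝ, 0 < r → r < r₀ →
        (resMinus k δ (tilde M) ε ∩ pdisc r = ∅ ∧
          ∑' w : ↥(resMinus k δ (tilde M) ε ∩ pdisc r), multMinus k (tilde M) ε w = 0) ∧
        (resPlus k δ (tilde M) ε ∩ pdisc r = ∅ ∧
          ∑' w : ↥(resPlus k δ (tilde M) ε ∩ pdisc r), multPlus k (tilde M) ε w = 0) := by
  have hδ0 : 0 < δ := by
    by_cases h : k = 1
    · exact hδ.1 h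
    · have hk2 : (1 : ℝ) < k := by exact_mod_cast lt_of_le_of_ne hk (Ne.symm h)
      linarith [hδ.2 h, Real.log_pos hk2]
  obtain ⟨ε, hε, H⟩ := exists_extensions hk hδ0
  refine ⟨ε, hε, fun M ⟨C, hM⟩ => ?_⟩
  obtain ⟨hR₁, hT₁, r₁, h₁, h₁', hp₁⟩ := H (tilde M) ⟨1 + C, norm_tilde_le hM⟩
  obtain ⟨hR₂, hT₂, r₂, h₂, -, hp₂⟩ := H (-tilde M)
    ⟨1 + C, fun v => by simpa using norm_tilde_le hM v⟩
  have hmono : ∀ {r s : ℝ}, r ≤ s → pdisc r ⊆ pdisc s := fun h _ hw => ⟨hw.1, hw.2.trans_le h⟩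
  -- The reflected parameter at `t₊` is `zMinus`, so the second threshold is `H` applied to `-tilde
  -- M`.
  rw [two_mul_sub_zPlus]
  refine ⟨hR₁, hR₂, hT₁, hT₂, min r₁ r₂, lt_min h₁ h₂, (min_le_left _ _).trans h₁',
    fun r _ hr => ?_⟩
  have e₁ : resMinus k δ (tilde M) ε ∩ pdisc r = ∅ := Set.subset_eq_empty
    (Set.inter_subset_inter_right _ (hmono (hr.le.trans (min_le_left _ _)))) hp₁
  have e₂ : resPlus k δ (tilde M) ε ∩ pdisc r = ∅ := by
    rw [resPlus, two_mul_sub_zPlus]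
    exact Set.subset_eq_empty
      (Set.inter_subset_inter_right _ (hmono (hr.le.trans (min_le_right _ _)))) hp₂
  refine ⟨⟨e₁, ?_⟩, e₂, ?_⟩
  · rw [e₁]
    exact tsum_empty
  · rw [e₂]
    exact tsum_empty
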